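/- Let $n\ge 0$ and let $\mathbb{Q}\langle X_n\rangle=\mathbb{Q}\langle x_1,\dots,x_n\rangle$ be the algebra of polynomials in $n$ noncommuting variables, graded by degree, with homogeneous components $V_r$ $(r\ge 0)$ spanned by the monomials of length $r$. The symmetric group $\mathfrak{S}_n$ acts on it by algebra automorphisms permuting the variables, $\sigma\cdot x_i=x_{\sigma(i)}$. Let $\mathit{Sym}$ be the ring of symmetric functions over $\mathbb{Q}$ in an infinite alphabet $X$, with power sums $p_k$ and complete homogeneous functions $h_k$ ($h_0=1$), and write $p_\lambda=\prod_i p_{\lambda_i}$, $h_\lambda=\prod_i h_{\lambda_i}$. For a finite-dimensional representation $V$ of $\mathfrak{S}_n$ over $\mathbb{Q}$ with character $\chi^V$, its Frobenius characteristic is $$\mathcal{F}rob_{\mathfrak{S}_n}(V)=\frac1{n!}\sum_{\sigma\in\mathfrak{S}_n}\chi^V(\sigma)\,p_{\mathrm{cyc}(\sigma)}[X],$$ where $\mathrm{cyc}(\sigma)$ is the cycle type of $\sigma$ (fixed points included), and the graded Frobenius characteristic of $\mathbb{Q}\langle X_n\rangle$ is the formal power series $\mathcal{F}rob_{\mathfrak{S}_n}(\mathbb{Q}\langle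 X_n\rangle)=\sum_{r\ge0}q^r\,\mathcal{F}rob_{\mathfrak{S}_n}(V_r)\in\mathit{Sym}[[q]]$. Then $$\mathcal{F}rob_{\mathfrak{S}_n}(\mathbb{Q}\langle X_n\rangle)=\sum_{d=0}^n\frac{q^d}{\{q;q\}_d}\,h_{(n-d,1^d)}[X],$$ where $\{q;q\}_d=(1-q)(1-2q)\cdots(1-dq)$ and $h_{(n-d,1^d)}=h_{n-d}h_1^d$. -/

import Mathlib

noncomputable section

/-- The ring `Sym` of symmetric functions over `ℚ` in the countably infinite alphabet
`x_0, x_1, x_2, …`: the formal power series of bounded degree that are invariant under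
all permutations of the variables. -/
def SymFun : Subalgebra ℚ (MvPowerSeries ℕ ℚ) where
  carrier := {f |
    (∀ (e : Equiv.Perm ℕ) (m : ℕ →₀ ℕ),
      MvPowerSeries.coeff (m.mapDomain e) f = MvPowerSeries.coeff m f) ∧
    ∃ N : ℕ, ∀ m : ℕ →₀ ℕ, MvPowerSeries.coeff m f ≠ 0 → m.degree ≤ N}
  mul_mem' := by
    classical
    rintro f g ⟨hf, Nf, hNf⟩ ⟨hg, Ng, hNg⟩
    refine ⟨fun e m => ?_, Nf + Ng, fun m hm => ?_⟩
    · rw [MvPowerSeries.coeff_mul, MvPowerSeries.coeff_mul]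
      symm
      have key : ∀ (e : Equiv.Perm ℕ) (a : ℕ →₀ ℕ),
          (a.mapDomain e).mapDomain e.symm = a := fun e a => by
        rw [← Finsupp.mapDomain_comp, Equiv.symm_comp_self, Finsupp.mapDomain_id]
      refine Finset.sum_nbij' (fun p => (p.1.mapDomain e, p.2.mapDomain e))
        (fun p => (p.1.mapDomain e.symm, p.2.mapDomain e.symm)) ?_ ?_ ?_ ?_ ?_
      · intro p hp
        rw [Finset.HasAntidiagonal.mem_antidiagonal] at hp ⊢
        rw [← hp, Finsupp.mapDomain_add]
      · intro p hp
        rw [Finset.HasAntidiagonal.mem_antidiagonal] at hp ⊢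
        rw [← key e m, ← hp, Finsupp.mapDomain_add]
      · intro p _
        simp only [key]
      · intro p _
        have := key e.symm
        rw [Equiv.symm_symm] at this
        simp only [this]
      · intro p _
        simp only [hf, hg]
    · rw [MvPowerSeries.coeff_mul] at hm
      obtain ⟨p, hp, hne⟩ := Finset.exists_ne_zero_of_sum_ne_zero hm
      rw [Finset.HasAntidiagonal.mem_antidiagonal] at hp
      rw [← hp, map_add]
      exact Nat.add_le_add (hNf _ (left_ne_zero_of_mul hne)) (hNg _ (right_ne_zero_of_mul hne))
  add_mem' := by
    rintro f g ⟨hf, Nf, hNf⟩ ⟨hg, Ng, hNg⟩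
    refine ⟨fun e m => by rw [map_add, map_add, hf, hg], max Nf Ng, fun m hm => ?_⟩
    rw [map_add] at hm
    by_cases h : MvPowerSeries.coeff m f = 0
    · rw [h, zero_add] at hm
      exact (hNg m hm).trans (le_max_right _ _)
    · exact (hNf m h).trans (le_max_left _ _)
  algebraMap_mem' := by
    classical
    intro r
    rw [MvPowerSeries.algebraMap_apply]
    refine ⟨fun e m => ?_, 0, fun m hm => ?_⟩
    · rw [MvPowerSeries.coeff_C, MvPowerSeries.coeff_C]
      have : m.mapDomain e = 0 ↔ m = 0 := by
        rw [← Finsupp.degree_eq_zero_iff, Finsupp.degree_mapDomain, Finsupp.degree_eq_zero_iff]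
      simp only [this]
    · rw [MvPowerSeries.coeff_C] at hm
      have : m = 0 := by
        by_contra h
        exact hm (if_neg h)
      simp [this]

namespace SymFun

open Classical in
/-- The power sum `p_k = ∑_i x_i ^ k` (for `k ≥ 1`): the sum of the monomials `x_i ^ k`. -/
def p (k : ℕ) : SymFun :=
  ⟨fun m => if ∃ i, m = Finsupp.single i k then 1 else 0, by
    refine ⟨fun e m => ?_, k, fun m hm => ?_⟩
    · have : (∃ i, m.mapDomain e = Finsupp.single i k) ↔ ∃ i, m = Finsupp.single i k := by
        constructor
        · rintro ⟨i, hi⟩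
          refine ⟨e.symm i, Finsupp.mapDomain_injective e.injective ?_⟩
          rw [hi, Finsupp.mapDomain_single, Equiv.apply_symm_apply]
        · rintro ⟨i, rfl⟩
          exact ⟨e i, Finsupp.mapDomain_single⟩
      change (if _ then (1 : ℚ) else 0) = if _ then 1 else 0
      simp only [this]
    · change (if _ then (1 : ℚ) else 0) ≠ 0 at hm
      obtain ⟨i, rfl⟩ : ∃ i, m = Finsupp.single i k := by
        by_contra h
        exact hm (if_neg h)
      rw [Finsupp.degree_single]⟩

/-- The complete homogeneous symmetric function `h_k`: the sum of all monomials of degree `k`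
(so `h_0 = 1`). -/
def h (k : ℕ) : SymFun :=
  ⟨fun m => if m.degree = k then 1 else 0, by
    refine ⟨fun e m => ?_, k, fun m hm => ?_⟩
    · change (if _ then (1 : ℚ) else 0) = if _ then 1 else 0
      rw [Finsupp.degree_mapDomain]
    · change (if _ then (1 : ℚ) else 0) ≠ 0 at hm
      by_contra hk
      exact hm (if_neg fun h => hk h.le)⟩

/-- `p_λ = p_{λ₁} p_{λ₂} ⋯`, for the multiset of parts of `λ`. -/
def pProd (l : Multiset ℕ) : SymFun := (l.map p).prod

/-- `h_λ = h_{λ₁} h_{λ₂} ⋯`, for the multiset of parts of `λ`; parts `0` contribute `h_0 = 1`. -/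
def hProd (l : Multiset ℕ) : SymFun := (l.map h).prod

end SymFun

/-- The Frobenius characteristic of a (finite-dimensional) representation of `S_n` over `ℚ`,
`(1 / n!) ∑_{σ ∈ S_n} χ(σ) p_{cyc(σ)}`, where `cyc(σ)` is the partition of `n` formed by the
lengths of all cycles of `σ`, fixed points included. -/
def frob {n : ℕ} {V : Type*} [AddCommGroup V] [Module ℚ V]
    (ρ : Representation ℚ (Equiv.Perm (Fin n)) V) : SymFun :=
  (n.factorial : ℚ)⁻¹ •
    ∑ σ : Equiv.Perm (Fin n), ρ.character σ • SymFun.pProd σ.partition.parts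

/-- The graded Frobenius characteristic `∑_r q ^ r Frob(V_r)`, an element of `Sym⟦q⟧`, of a
representation of `S_n` graded by the subrepresentations `V_r`. -/
def gradedFrob {n : ℕ} {V : Type*} [AddCommGroup V] [Module ℚ V]
    {ρ : Representation ℚ (Equiv.Perm (Fin n)) V} (A : ℕ → Subrepresentation ρ)
    (_hA : DirectSum.IsInternal fun r => (A r).toSubmodule)
    (_hfin : ∀ r, Module.Finite ℚ (A r).toSubmodule) : PowerSeries SymFun :=
  PowerSeries.mk fun r => frob (A r).toRepresentation

/-- The action of `S_n` on `ℚ⟨X_n⟩` on variables: `σ` acts as the algebra endomorphism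
with `x_i ↦ x_{σ(i)}`. -/
def variableAction (n : ℕ) :
    Representation ℚ (Equiv.Perm (Fin n)) (FreeAlgebra ℚ (Fin n)) where
  toFun σ := (FreeAlgebra.lift ℚ fun i => FreeAlgebra.ι ℚ (σ i)).toLinearMap
  map_one' := by
    have : (FreeAlgebra.lift ℚ fun i : Fin n => FreeAlgebra.ι ℚ i) = AlgHom.id ℚ _ := by
      ext i; simp
    simp only [Equiv.Perm.one_apply, this]
    rfl
  map_mul' σ τ := by
    rw [Module.End.mul_eq_comp, ← AlgHom.comp_toLinearMap]
    congr 1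
    ext i
    simp

/-- The monomial `x_{w_1} x_{w_2} ⋯ x_{w_r}` of `ℚ⟨X_n⟩`. -/
def ncMonomial {n : ℕ} (w : List (Fin n)) : FreeAlgebra ℚ (Fin n) :=
  (w.map (FreeAlgebra.ι ℚ)).prod

theorem variableAction_ncMonomial {n : ℕ} (σ : Equiv.Perm (Fin n)) (w : List (Fin n)) :
    variableAction n σ (ncMonomial w) = ncMonomial (w.map σ) := by
  change FreeAlgebra.lift ℚ (fun i => FreeAlgebra.ι ℚ (σ i)) (ncMonomial w) = _
  simp only [ncMonomial, map_list_prod, List.map_map]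
  congr 2
  ext i
  simp

/-- The homogeneous component of degree `r` of `ℚ⟨X_n⟩`, spanned by the monomials of degree `r`,
as a subrepresentation. -/
def ncHomogeneous (n r : ℕ) : Subrepresentation (variableAction n) where
  toSubmodule := Submodule.span ℚ (ncMonomial '' {w : List (Fin n) | w.length = r})
  apply_mem_toSubmodule σ v hv := by
    induction hv using Submodule.span_induction with
    | mem x hx =>
      obtain ⟨w, hw, rfl⟩ := hx
      rw [variableAction_ncMonomial]
      exact Submodule.subset_span ⟨_, by simpa using hw, rfl⟩
    | zero => rw [map_zero]; exact Submodule.zero_mem _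
    | add x y _ _ hx hy => rw [map_add]; exact Submodule.add_mem _ hx hy
    | smul c x _ hx => rw [map_smul]; exact Submodule.smul_mem _ c hx

theorem ncHomogeneous_finite (n r : ℕ) :
    Module.Finite ℚ (ncHomogeneous n r).toSubmodule :=
  Module.Finite.span_of_finite ℚ ((List.finite_length_eq (Fin n) r).image _)

theorem ncMonomial_eq_basis {n : ℕ} (w : FreeMonoid (Fin n)) :
    ncMonomial w.toList = FreeAlgebra.basisFreeMonoid ℚ (Fin n) w := by
  have h1 : FreeAlgebra.basisFreeMonoid ℚ (Fin n) w =
      FreeAlgebra.equivMonoidAlgebraFreeMonoid.symm (MonoidAlgebra.single w 1) := by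
    simp [FreeAlgebra.basisFreeMonoid]
  have h2 : ∀ a, (FreeAlgebra.equivMonoidAlgebraFreeMonoid (R := ℚ) (X := Fin n)).symm a =
      MonoidAlgebra.lift ℚ (FreeAlgebra ℚ (Fin n)) (FreeMonoid (Fin n))
        (FreeMonoid.lift (FreeAlgebra.ι ℚ)) a := fun _ => rfl
  rw [h1, h2, MonoidAlgebra.lift_single, one_smul, FreeMonoid.lift_apply, ncMonomial]

theorem ncHomogeneous_isInternal (n : ℕ) :
    DirectSum.IsInternal fun r => (ncHomogeneous n r).toSubmodule := by
  have hb : (ncMonomial : List (Fin n) → _) =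
      FreeAlgebra.basisFreeMonoid ℚ (Fin n) ∘ FreeMonoid.ofList :=
    funext fun w => ncMonomial_eq_basis (FreeMonoid.ofList w)
  have hli : LinearIndependent ℚ (ncMonomial : List (Fin n) → _) := by
    rw [hb]
    exact (FreeAlgebra.basisFreeMonoid ℚ (Fin n)).linearIndependent.comp _
      FreeMonoid.ofList.injective
  refine DirectSum.isInternal_submodule_of_iSupIndep_of_iSup_eq_top (fun r => ?_) ?_
  · simp only [ncHomogeneous, ← Submodule.span_iUnion, ← Set.image_iUnion]
    refine hli.disjoint_span_image ?_
    rw [Set.disjoint_left]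
    rintro w hw hw'
    simp only [Set.mem_iUnion, Set.mem_ofPred_eq] at hw hw'
    obtain ⟨j, hj, rfl⟩ := hw'
    exact hj hw
  · simp only [ncHomogeneous, ← Submodule.span_iUnion, ← Set.image_iUnion]
    have : (⋃ r, {w : List (Fin n) | w.length = r}) = Set.univ := by ext; simp
    rw [this, Set.image_univ, hb, Set.range_comp, FreeMonoid.ofList.range_eq_univ,
      Set.image_univ]
    exact (FreeAlgebra.basisFreeMonoid ℚ (Fin n)).span_eq

/-- `{q;q}_d = (1 - q)(1 - 2q) ⋯ (1 - dq)`. -/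
def curlyPochhammer (d : ℕ) : PowerSeries ℚ :=
  ∏ i ∈ Finset.Icc 1 d, (1 - PowerSeries.C (i : ℚ) * PowerSeries.X)

end

/-! A permutation `σ` permutes the words of length `r`, so its character on the degree-`r` component
is `fix(σ) ^ r` (`character_ncHomogeneous`). Stirling numbers of the second kind expand this power
in falling factorials of `fix(σ)`, and `q ^ d / {q;q}_d` is the generating function of those numbers
in `r`. It remains to see that weighting `p_{cyc(σ)}` by the `d`-th falling factorial of `fix(σ)`
and averaging over `S_n` gives `h_{n-d} h_1 ^ d` (`sum_descFactorial_smul_pProd`). Removing marked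
fixed points one at a time, each contributing `p_1 = h_1`, reduces this to `d = 0`, that is `∑
p_{cyc(σ)} = n! h_n` (`sum_pProd_partition`), which is a count of pairs (permutation, invariant
colouring). -/

/-! ### Coefficients of power sums and complete functions. -/

theorem SymFun.coeff_p (k : ℕ) (m : ℕ →₀ ℕ) [Decidable (∃ i, m = Finsupp.single i k)] :
    MvPowerSeries.coeff m (SymFun.p k : MvPowerSeries ℕ ℚ) =
      if ∃ i, m = Finsupp.single i k then 1 else 0 := by
  rw [MvPowerSeries.coeff_apply]
  by_cases h : ∃ i, m = Finsupp.single i k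
  · rw [if_pos h]
    exact if_pos h
  · rw [if_neg h]
    exact if_neg h

theorem SymFun.coeff_h (k : ℕ) (m : ℕ →₀ ℕ) :
    MvPowerSeries.coeff m (SymFun.h k : MvPowerSeries ℕ ℚ) =
      if m.degree = k then 1 else 0 := rfl

theorem SymFun.p_one : SymFun.p 1 = SymFun.h 1 := by
  classical
  refine Subtype.ext (MvPowerSeries.ext fun m => ?_)
  rw [SymFun.coeff_h, SymFun.coeff_p]
  have : (∃ i, m = Finsupp.single i 1) ↔ m.degree = 1 := by
    simpa only [Set.mem_range, Set.mem_ofPred_eq, eq_comm] using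
      Set.ext_iff.1 Finsupp.range_single_one m
  simp only [this]

-- Expanding the product chooses a variable in each factor. Nonzero exponents make the choice
-- recoverable from the monomial `x_i ^ k`.
open Finset in
theorem SymFun.coeff_prod_p {ι : Type*} [Fintype ι] (k : ι → ℕ) (hk : ∀ c, k c ≠ 0)
    (m : ℕ →₀ ℕ) :
    MvPowerSeries.coeff m ((∏ c, SymFun.p (k c) : SymFun) : MvPowerSeries ℕ ℚ) =
      Nat.card {g : ι → ℕ // ∑ c, Finsupp.single (g c) (k c) = m} := by
  classical
  rw [show ((∏ c, SymFun.p (k c) : SymFun) : MvPowerSeries ℕ ℚ) =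
    ∏ c, (SymFun.p (k c) : MvPowerSeries ℕ ℚ) from map_prod SymFun.val _ _,
    MvPowerSeries.coeff_prod]
  simp only [SymFun.coeff_p, Fintype.prod_boole]
  refine (Finset.sum_boole _ _).trans ?_
  congr 1
  rw [← Nat.card_eq_finsetCard]
  symm
  refine Nat.card_eq_of_bijective (fun g => ⟨Finsupp.equivFunOnFinite.symm fun c =>
    Finsupp.single (g.1 c) (k c), ?_⟩) ⟨fun g g' h => ?_, ?_⟩
  · rw [mem_filter, mem_finsuppAntidiag]
    exact ⟨⟨g.2, subset_univ _⟩, fun i => ⟨_, rfl⟩⟩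
  · refine Subtype.ext (funext fun c => ?_)
    have h1 := DFunLike.congr_fun (congrArg Subtype.val h) c
    exact Finsupp.single_left_injective (hk c) h1
  · rintro ⟨l, hl⟩
    rw [mem_filter, mem_finsuppAntidiag] at hl
    choose g hg using fun c => hl.2 c
    have hgl : ∀ c, Finsupp.single (g c) (k c) = l c := fun c => (hg c).symm
    refine ⟨⟨g, by simp only [hgl]; exact hl.1.1⟩, Subtype.ext (Finsupp.ext fun c => ?_)⟩
    exact hgl c

/-! ### Colourings and their contents. -/

/-- The content of a colouring, as a monomial in the colours. -/
noncomputable def colouringContent {α : Type*} [Fintype α] (f : α → ℕ) : ℕ →₀ ℕ := ∑ i, Finsupp.single (f i) 1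

theorem colouringContent_comp {α : Type*} [Fintype α] (f : α → ℕ) (σ : Equiv.Perm α) :
    colouringContent (f ∘ σ) = colouringContent f :=
  Equiv.sum_comp σ fun i => Finsupp.single (f i) 1

theorem colouringContent_apply {α : Type*} [Fintype α] (f : α → ℕ) (a : ℕ) :
    colouringContent f a = Nat.card {i : α // f i = a} := by
  classical
  rw [colouringContent, Finsupp.finsetSum_apply, Nat.card_eq_fintype_card, Fintype.card_subtype,
    Finset.card_filter]
  simp only [Finsupp.single_apply]

theorem degree_colouringContent {α : Type*} [Fintype α] (f : α → ℕ) :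
    (colouringContent f).degree = Fintype.card α := by
  simp [colouringContent, map_sum]

theorem exists_colouringContent_eq {α : Type*} [Fintype α] {m : ℕ →₀ ℕ}
    (hm : m.degree = Fintype.card α) : ∃ f : α → ℕ, colouringContent f = m := by
  -- The model set has `m a` points of each colour `a`.
  have hcard : Fintype.card α = Fintype.card (Σ a : m.support, Fin (m a)) := by
    rw [Fintype.card_sigma, ← hm, Finsupp.degree_apply, ← Finset.sum_coe_sort]
    simp
  let e := Fintype.equivOfCardEq hcard
  refine ⟨fun i => (e i).1, ?_⟩
  rw [colouringContent, e.sum_comp (fun x => Finsupp.single (x.1 : ℕ) 1), Fintype.sum_sigma]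
  simp only [Finset.sum_const, Finset.card_univ, Fintype.card_fin, Finsupp.smul_single, smul_eq_mul,
    mul_one]
  rw [Finset.sum_coe_sort m.support fun a => Finsupp.single a (m a)]
  exact m.sum_single

theorem exists_perm_comp_eq {α : Type*} [Fintype α] {f g : α → ℕ}
    (h : colouringContent f = colouringContent g) : ∃ τ : Equiv.Perm α, f ∘ τ = g := by
  have hc : ∀ a, Nonempty ({i // g i = a} ≃ {i // f i = a}) := fun a => by
    rw [← Finite.card_eq, ← colouringContent_apply, ← colouringContent_apply, h]
  exact ⟨Equiv.ofFiberEquiv fun a => (hc a).some, funext fun i => Equiv.ofFiberEquiv_map _ i⟩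

/-! ### Cycles, invariant colourings and the sum of all `p_{cyc(σ)}`. -/

namespace Equiv.Perm

variable {α : Type*} [Fintype α]

theorem SameCycle.apply_eq_of_comp_eq {β : Type*} {σ : Perm α} {f : α → β} (hf : f ∘ σ = f)
    {i j : α} (h : σ.SameCycle i j) : f i = f j := by
  obtain ⟨k, rfl⟩ := h.exists_nat_pow_eq
  induction k with
  | zero => rfl
  | succ k ih =>
    rw [pow_succ', mul_apply, ← Function.comp_apply (f := f), hf]
    exact ih ⟨k, by simp⟩

variable [DecidableEq α]

/-- The cycles of a permutation, fixed points included. -/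
abbrev FullCycles (σ : Perm α) : Type _ := σ.cycleFactorsFinset ⊕ {i : α // σ i = i}

/-- The length of a cycle. -/
def FullCycles.length {σ : Perm α} : σ.FullCycles → ℕ :=
  Sum.elim (fun c => c.1.support.card) fun _ => 1

/-- The cycle containing a given point. -/
def toFullCycle (σ : Perm α) (i : α) : σ.FullCycles :=
  if h : σ i = i then Sum.inr ⟨i, h⟩
  else Sum.inl ⟨σ.cycleOf i, cycleOf_mem_cycleFactorsFinset_iff.2 (mem_support.2 h)⟩

theorem FullCycles.length_ne_zero {σ : Perm α} (c : σ.FullCycles) : c.length ≠ 0 := by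
  rcases c with c | c
  · exact (Finset.card_pos.2 (mem_cycleFactorsFinset_iff.1 c.2).1.nonempty_support).ne'
  · exact one_ne_zero

theorem toFullCycle_eq_inl {σ : Perm α} {i : α} {c : σ.cycleFactorsFinset} :
    σ.toFullCycle i = Sum.inl c ↔ i ∈ c.1.support := by
  unfold toFullCycle
  split_ifs with h
  · simp only [false_iff]
    exact fun hi => mem_support.1 (mem_cycleFactorsFinset_support_le c.2 hi) h
  · rw [Sum.inl.injEq, Subtype.ext_iff]
    constructor
    · intro hc
      rw [← hc, mem_support_cycleOf_iff]
      exact ⟨.rfl, mem_support.2 h⟩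
    · intro hc
      exact (cycle_is_cycleOf hc c.2).symm

theorem toFullCycle_eq_inr {σ : Perm α} {i : α} {c : {i : α // σ i = i}} :
    σ.toFullCycle i = Sum.inr c ↔ i = c.1 := by
  unfold toFullCycle
  split_ifs with h
  · rw [Sum.inr.injEq, Subtype.ext_iff]
  · simp only [false_iff]
    rintro rfl
    exact h c.2

theorem card_toFullCycle_fiber {σ : Perm α} (c : σ.FullCycles) :
    (Finset.univ.filter fun i => σ.toFullCycle i = c).card = c.length := by
  rcases c with c | c
  · simp only [toFullCycle_eq_inl, Finset.filter_univ_mem]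
    rfl
  · simp only [toFullCycle_eq_inr, Finset.filter_eq', Finset.mem_univ, if_true,
      Finset.card_singleton]
    rfl

theorem toFullCycle_surjective (σ : Perm α) : Function.Surjective σ.toFullCycle := by
  intro c
  have := Finset.card_pos.1
    ((card_toFullCycle_fiber c).symm ▸ Nat.pos_of_ne_zero c.length_ne_zero)
  obtain ⟨i, hi⟩ := this
  exact ⟨i, (Finset.mem_filter.1 hi).2⟩

theorem toFullCycle_apply (σ : Perm α) (i : α) : σ.toFullCycle (σ i) = σ.toFullCycle i := by
  by_cases h : σ i = i
  · rw [h]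
  · have h' : ¬ σ (σ i) = σ i := fun h' => h (σ.injective h')
    simp only [toFullCycle, h, h', dif_neg, not_false_eq_true, cycleOf_self_apply]

theorem sameCycle_of_toFullCycle_eq {σ : Perm α} {i j : α}
    (h : σ.toFullCycle i = σ.toFullCycle j) : σ.SameCycle i j := by
  rcases hj : σ.toFullCycle j with c | c
  · rw [hj] at h
    have h1 := cycle_is_cycleOf (toFullCycle_eq_inl.1 h) c.2
    have h2 := toFullCycle_eq_inl.1 hj
    rw [h1, mem_support_cycleOf_iff] at h2
    exact h2.1
  · rw [hj] at h
    rw [toFullCycle_eq_inr.1 h, toFullCycle_eq_inr.1 hj]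

theorem pProd_partition (σ : Perm α) :
    SymFun.pProd σ.partition.parts = ∏ c : σ.FullCycles, SymFun.p c.length := by
  rw [Fintype.prod_sum_type, SymFun.pProd, parts_partition, Multiset.map_add, Multiset.prod_add,
    cycleType_def, Multiset.map_map]
  congr 1
  · exact (Finset.prod_coe_sort σ.cycleFactorsFinset
      fun c => SymFun.p c.support.card).symm
  · simp only [FullCycles.length, Sum.elim_inr, Finset.prod_const, Multiset.map_replicate,
      Multiset.prod_replicate, Finset.card_univ]
    congr 1
    rw [Fintype.card_subtype, ← Finset.card_compl]
    congr 1
    ext i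
    simp

theorem colouringContent_comp_toFullCycle (σ : Perm α) (g : σ.FullCycles → ℕ) :
    colouringContent (g ∘ σ.toFullCycle) = ∑ c, Finsupp.single (g c) c.length := by
  unfold colouringContent
  rw [← Finset.sum_fiberwise (s := Finset.univ) (g := σ.toFullCycle)]
  refine Finset.sum_congr rfl fun c _ => ?_
  rw [Finset.sum_congr rfl (g := fun _ => Finsupp.single (g c) 1), Finset.sum_const,
    card_toFullCycle_fiber, Finsupp.smul_single, smul_eq_mul, mul_one]
  intro i hi
  rw [Function.comp_apply, (Finset.mem_filter.1 hi).2]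

/-- An invariant colouring is constant on cycles, so it amounts to a choice of one variable per
cycle, raised to the cycle length. -/
theorem coeff_pProd_partition (σ : Perm α) (m : ℕ →₀ ℕ) :
    MvPowerSeries.coeff m (SymFun.pProd σ.partition.parts : MvPowerSeries ℕ ℚ) =
      Nat.card {f : α → ℕ // colouringContent f = m ∧ f ∘ σ = f} := by
  rw [pProd_partition, SymFun.coeff_prod_p _ FullCycles.length_ne_zero]
  congr 1
  refine Nat.card_eq_of_bijective (fun g => ⟨g.1 ∘ σ.toFullCycle,
    (colouringContent_comp_toFullCycle σ g.1).trans g.2,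
    funext fun i => congrArg g.1 (toFullCycle_apply σ i)⟩) ⟨fun g g' h => ?_, ?_⟩
  · exact Subtype.ext (σ.toFullCycle_surjective.injective_comp_right (congrArg Subtype.val h))
  · rintro ⟨f, hf, hσ⟩
    have hfac : f.FactorsThrough σ.toFullCycle :=
      fun i j h => (sameCycle_of_toFullCycle_eq h).apply_eq_of_comp_eq hσ
    have hg := hfac.extend_comp (fun _ => 0)
    refine ⟨⟨Function.extend σ.toFullCycle f fun _ => 0, ?_⟩, Subtype.ext hg⟩
    rw [← colouringContent_comp_toFullCycle, hg, hf]

/-- Orbit counting made bijective: fix `f₀` of content `m` and, for each `f` of that content, some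
`τ f` carrying `f₀` to `f`. Then `(σ, f) ↦ τ f * σ` is a bijection onto all permutations: composing
`f₀` with the image returns `f`, and cancellation returns `σ`. -/
theorem sum_card_fixed_colourings {m : ℕ →₀ ℕ} (hm : m.degree = Fintype.card α) :
    ∑ σ : Perm α, Nat.card {f : α → ℕ // colouringContent f = m ∧ f ∘ σ = f} =
      (Fintype.card α).factorial := by
  obtain ⟨f₀, hf₀⟩ := exists_colouringContent_eq hm
  have hex : ∀ f : α → ℕ, ∃ τ : Perm α, colouringContent f = m → f₀ ∘ τ = f := fun f => by
    by_cases hf : colouringContent f = m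
    · obtain ⟨τ, hτ⟩ := exists_perm_comp_eq (hf₀.trans hf.symm)
      exact ⟨τ, fun _ => hτ⟩
    · exact ⟨1, fun h => absurd h hf⟩
  choose τ hτ using hex
  let F : (Σ σ : Perm α, {f : α → ℕ // colouringContent f = m ∧ f ∘ σ = f}) → Perm α :=
    fun x => τ x.2.1 * x.1
  have hF : ∀ x, f₀ ∘ F x = x.2.1 := fun x => by
    rw [show f₀ ∘ F x = (f₀ ∘ τ x.2.1) ∘ x.1 from rfl, hτ _ x.2.2.1, x.2.2.2]
  have hbij : Function.Bijective F := by
    refine ⟨fun x y hxy => ?_, fun ρ => ?_⟩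
    · have h2 : x.2.1 = y.2.1 := by rw [← hF, ← hF, hxy]
      obtain ⟨σ, f, hf⟩ := x
      obtain ⟨σ', f', hf'⟩ := y
      obtain rfl : f = f' := h2
      obtain rfl : σ = σ' := mul_left_cancel hxy
      rfl
    · have hc : colouringContent (f₀ ∘ ρ) = m := (colouringContent_comp _ _).trans hf₀
      refine ⟨⟨(τ (f₀ ∘ ρ))⁻¹ * ρ, f₀ ∘ ρ, hc, ?_⟩, mul_inv_cancel_left _ _⟩
      funext i
      calc (f₀ ∘ ρ) (((τ (f₀ ∘ ρ))⁻¹ * ρ) i)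
          = (f₀ ∘ τ (f₀ ∘ ρ)) (((τ (f₀ ∘ ρ))⁻¹ * ρ) i) := by rw [hτ _ hc]
        _ = (f₀ ∘ ρ) i := by simp
  -- Colours range over all of `ℕ`, so finiteness of the fibres is not automatic; it is read off
  -- from the injectivity of `F`.
  have hfin : ∀ σ : Perm α, Finite {f : α → ℕ // colouringContent f = m ∧ f ∘ σ = f} := fun σ =>
    Finite.of_injective (fun f => F ⟨σ, f⟩) fun f g hfg => by
      simpa using hbij.1 hfg
  rw [← Nat.card_sigma, Nat.card_eq_of_bijective F hbij, Nat.card_eq_fintype_card,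
    Fintype.card_perm]

theorem sum_pProd_partition :
    ∑ σ : Perm α, SymFun.pProd σ.partition.parts =
      ((Fintype.card α).factorial : ℚ) • SymFun.h (Fintype.card α) := by
  refine Subtype.ext (MvPowerSeries.ext fun m => ?_)
  rw [AddSubmonoidClass.coe_finsetSum, map_sum, SetLike.val_smul, MvPowerSeries.coeff_smul,
    SymFun.coeff_h]
  simp only [coeff_pProd_partition]
  split_ifs with hm
  · rw [mul_one, ← sum_card_fixed_colourings hm, Nat.cast_sum]
  · rw [mul_zero]
    refine Finset.sum_eq_zero fun σ _ => ?_
    rw [Nat.cast_eq_zero, Nat.card_eq_zero]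
    exact Or.inl ⟨fun f => hm (f.2.1 ▸ degree_colouringContent f.1)⟩

end Equiv.Perm

/-! ### Fixed points and falling factorials. -/

namespace Equiv.Perm

/-- The number of fixed points of a permutation. -/
def fixCard {α : Type*} [Fintype α] [DecidableEq α] (σ : Perm α) : ℕ :=
  (Finset.univ.filter fun i => σ i = i).card

theorem fixCard_add_card_support {α : Type*} [Fintype α] [DecidableEq α] (σ : Perm α) :
    σ.fixCard + σ.support.card = Fintype.card α :=
  Finset.card_filter_add_card_filter_not _

/-- The permutation of `Fin (n + 1)` fixing `i` that acts as `τ` on the other points. -/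
abbrev insertFixed {n : ℕ} (i : Fin (n + 1)) (τ : Perm (Fin n)) : Perm (Fin (n + 1)) :=
  τ.extendDomain (finSuccAboveEquiv i)

theorem fixCard_insertFixed {n : ℕ} (i : Fin (n + 1)) (τ : Perm (Fin n)) :
    (insertFixed i τ).fixCard = τ.fixCard + 1 := by
  have h1 := fixCard_add_card_support (insertFixed i τ)
  have h2 := fixCard_add_card_support τ
  rw [card_support_extend_domain, Fintype.card_fin] at h1
  rw [Fintype.card_fin] at h2
  omega

theorem pProd_partition_insertFixed {n : ℕ} (i : Fin (n + 1)) (τ : Perm (Fin n)) :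
    SymFun.pProd (insertFixed i τ).partition.parts =
      SymFun.p 1 * SymFun.pProd τ.partition.parts := by
  have h2 := fixCard_add_card_support τ
  rw [Fintype.card_fin] at h2
  have h3 : n + 1 - τ.support.card = (n - τ.support.card) + 1 := by omega
  simp only [SymFun.pProd, parts_partition, cycleType_extendDomain, card_support_extend_domain,
    Fintype.card_fin, h3, Multiset.replicate_succ, Multiset.add_cons, Multiset.map_cons,
    Multiset.prod_cons]

theorem sum_filter_fixed {n : ℕ} {M : Type*} [AddCommMonoid M] (i : Fin (n + 1))
    (F : Perm (Fin (n + 1)) → M) :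
    ∑ σ with σ i = i, F σ = ∑ τ, F (insertFixed i τ) := by
  symm
  refine Finset.sum_nbij (insertFixed i) (fun τ _ => ?_) (fun τ _ τ' _ h => ?_)
    (fun σ hσ => ?_) fun _ _ => rfl
  · exact Finset.mem_filter.2
      ⟨Finset.mem_univ _, extendDomain_apply_not_subtype _ _ (by simp)⟩
  · exact extendDomainHom_injective (finSuccAboveEquiv i) h
  · have hi : σ i = i := (Finset.mem_filter.1 hσ).2
    have hp : ∀ x, σ x ≠ i ↔ x ≠ i := fun x => by
      rw [ne_eq, ne_eq, ← σ.injective.eq_iff (a := x), hi]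
    refine ⟨(finSuccAboveEquiv i).symm.permCongr (σ.subtypePerm hp),
      Finset.mem_coe.2 (Finset.mem_univ _), ?_⟩
    ext x
    by_cases hx : x = i
    · subst hx
      rw [insertFixed, extendDomain_apply_not_subtype _ _ (by simp), hi]
    · rw [insertFixed, extendDomain_apply_subtype (p := fun x => x ≠ i) _ _ hx]
      simp [Equiv.permCongr_apply]

/-- The falling factorial is `x` times that of `x - 1`; the factor `x` marks a fixed point `i`.
Deleting `i` leaves a permutation of `n` points and a factor `p_1`, for each of the `n + 1` values
of `i`. -/
theorem sum_descFactorial_smul_pProd_succ (n d : ℕ) :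
    ∑ σ : Perm (Fin (n + 1)),
        (σ.fixCard.descFactorial (d + 1) : ℚ) • SymFun.pProd σ.partition.parts =
      ((n + 1 : ℕ) : ℚ) • (SymFun.h 1 * ∑ τ : Perm (Fin n),
        (τ.fixCard.descFactorial d : ℚ) • SymFun.pProd τ.partition.parts) := by
  have key : ∀ σ : Perm (Fin (n + 1)),
      (σ.fixCard.descFactorial (d + 1) : ℚ) • SymFun.pProd σ.partition.parts =
        ∑ i, if σ i = i then
          ((σ.fixCard - 1).descFactorial d : ℚ) • SymFun.pProd σ.partition.parts else 0 := by
    intro σ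
    rw [← Finset.sum_filter, Finset.sum_const, ← fixCard, ← Nat.cast_smul_eq_nsmul ℚ, smul_smul,
      ← Nat.cast_mul]
    congr 2
    -- With no fixed points the truncated `0 - 1` is harmless: its term has multiplicity `0`.
    cases σ.fixCard with
    | zero => simp
    | succ k => rw [Nat.succ_descFactorial_succ, Nat.add_sub_cancel]
  rw [Finset.sum_congr rfl fun σ _ => key σ, Finset.sum_comm]
  simp only [← Finset.sum_filter, sum_filter_fixed, fixCard_insertFixed,
    pProd_partition_insertFixed, Nat.add_sub_cancel, Finset.sum_const, Finset.card_univ,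
    Fintype.card_fin, SymFun.p_one]
  rw [← Nat.cast_smul_eq_nsmul ℚ, Finset.mul_sum]
  simp only [mul_smul_comm]

theorem sum_descFactorial_smul_pProd {n d : ℕ} (hd : d ≤ n) :
    ∑ σ : Perm (Fin n),
        (σ.fixCard.descFactorial d : ℚ) • SymFun.pProd σ.partition.parts =
      (n.factorial : ℚ) • (SymFun.h (n - d) * SymFun.h 1 ^ d) := by
  induction d generalizing n with
  | zero =>
    have := sum_pProd_partition (α := Fin n)
    simpa using this.trans (by rw [Fintype.card_fin])
  | succ d ih =>
    obtain ⟨n, rfl⟩ := Nat.exists_eq_add_of_le' (Nat.one_le_of_lt hd)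
    rw [sum_descFactorial_smul_pProd_succ, ih (Nat.le_of_succ_le_succ hd), Nat.add_sub_add_right,
      mul_smul_comm, smul_smul, ← Nat.cast_mul, ← Nat.factorial_succ, pow_succ, ← mul_assoc,
      mul_comm]
    congr 1
    ring

end Equiv.Perm

/-! ### Stirling numbers of the second kind. -/

theorem coeff_X_pow_mul_curlyPochhammer_inv (r d : ℕ) :
    PowerSeries.coeff r (PowerSeries.X ^ d * (curlyPochhammer d)⁻¹) =
      (r.stirlingSecond d : ℚ) := by
  have hc : ∀ d, PowerSeries.constantCoeff (curlyPochhammer d) ≠ 0 := fun d => by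
    simp [curlyPochhammer, map_prod]
  induction d generalizing r with
  | zero =>
    cases r with
    | zero => simp [curlyPochhammer]
    | succ r => simp [curlyPochhammer, PowerSeries.coeff_one]
  | succ d ih =>
    set S : PowerSeries ℚ := PowerSeries.X ^ (d + 1) * (curlyPochhammer (d + 1))⁻¹ with hS
    have hprod : curlyPochhammer (d + 1) =
        curlyPochhammer d * (1 - PowerSeries.C ((d + 1 : ℕ) : ℚ) * PowerSeries.X) := by
      rw [curlyPochhammer, Finset.prod_Icc_succ_top (by omega), curlyPochhammer]
    -- The outer factor `X` makes the coefficient at `r + 1` depend only on coefficients at `r`,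
    -- which is the Stirling recurrence.
    have hrec : S = PowerSeries.X * (PowerSeries.C ((d + 1 : ℕ) : ℚ) * S +
        PowerSeries.X ^ d * (curlyPochhammer d)⁻¹) := by
      have h1 := PowerSeries.mul_inv_cancel _ (hc d)
      have h2 := PowerSeries.mul_inv_cancel _ (hc (d + 1))
      have h3 : S * (1 - PowerSeries.C ((d + 1 : ℕ) : ℚ) * PowerSeries.X) =
          PowerSeries.X ^ (d + 1) * (curlyPochhammer d)⁻¹ := by
        rw [hprod] at h2
        rw [hS, hprod]
        linear_combination (PowerSeries.X ^ (d + 1) * (curlyPochhammer d)⁻¹) * h2 -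
          (PowerSeries.X ^ (d + 1) *
            (curlyPochhammer d * (1 - PowerSeries.C ((d + 1 : ℕ) : ℚ) * PowerSeries.X))⁻¹ *
            (1 - PowerSeries.C ((d + 1 : ℕ) : ℚ) * PowerSeries.X)) * h1
      linear_combination h3
    induction r with
    | zero => rw [hrec]; simp
    | succ r ihr =>
      rw [hrec, PowerSeries.coeff_succ_X_mul, map_add, PowerSeries.coeff_C_mul, ihr, ih,
        Nat.stirlingSecond_succ_succ]
      push_cast
      ring

/-- Terms with `d > x` vanish, so the range can depend on `n` alone, uniformly in `r` and in the
permutation. -/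
theorem pow_eq_sum_stirlingSecond_mul_descFactorial {n x : ℕ} (hx : x ≤ n) (r : ℕ) :
    x ^ r = ∑ d ∈ Finset.range (n + 1), r.stirlingSecond d * x.descFactorial d := by
  induction r with
  | zero =>
    rw [Finset.sum_range_succ']
    simp
  | succ r ih =>
    have hx0 : r.stirlingSecond n * x.descFactorial (n + 1) = 0 := by
      rw [Nat.descFactorial_of_lt (Nat.lt_succ_of_le hx), mul_zero]
    have hmul : ∀ d, x * x.descFactorial d = x.descFactorial (d + 1) + d * x.descFactorial d := by
      intro d
      rw [Nat.descFactorial_succ, ← add_mul]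
      rcases le_or_gt d x with h | h
      · rw [Nat.sub_add_cancel h]
      · simp [Nat.descFactorial_of_lt h]
    calc x ^ (r + 1)
        = ∑ d ∈ Finset.range (n + 1), r.stirlingSecond d * x.descFactorial (d + 1) +
          ∑ d ∈ Finset.range (n + 1), r.stirlingSecond d * (d * x.descFactorial d) := by
          rw [pow_succ', ih, Finset.mul_sum, ← Finset.sum_add_distrib]
          refine Finset.sum_congr rfl fun d _ => ?_
          rw [← mul_add, ← hmul]
          ring
      _ = ∑ d ∈ Finset.range (n + 1), (r + 1).stirlingSecond d * x.descFactorial d := by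
        rw [Finset.sum_range_succ, hx0, add_zero, Finset.sum_range_succ' _ n,
          Finset.sum_range_succ' _ n, Nat.stirlingSecond_succ_zero, zero_mul, mul_zero,
          add_zero, add_zero, ← Finset.sum_add_distrib]
        refine Finset.sum_congr rfl fun d _ => ?_
        rw [Nat.stirlingSecond_succ_succ]
        ring

/-! ### Characters of the homogeneous components and conclusion. -/

theorem LinearMap.trace_eq_card_fixed {R M ι : Type*} [CommRing R] [AddCommGroup M] [Module R M]
    [Fintype ι] [DecidableEq ι] (b : Module.Basis ι R M) (f : M →ₗ[R] M) (s : ι → ι)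
    (hf : ∀ i, f (b i) = b (s i)) :
    LinearMap.trace R M f = (Finset.univ.filter fun i => s i = i).card := by
  rw [LinearMap.trace_eq_matrix_trace R b, Matrix.trace, Finset.card_filter, Nat.cast_sum]
  refine Finset.sum_congr rfl fun i _ => ?_
  rw [Matrix.diag_apply, LinearMap.toMatrix_apply, hf, Module.Basis.repr_self,
    Finsupp.single_apply]
  simp

theorem linearIndependent_ncMonomial (n : ℕ) :
    LinearIndependent ℚ (ncMonomial : List (Fin n) → FreeAlgebra ℚ (Fin n)) := by
  have hb : (ncMonomial : List (Fin n) → _) =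
      FreeAlgebra.basisFreeMonoid ℚ (Fin n) ∘ FreeMonoid.ofList :=
    funext fun w => ncMonomial_eq_basis (FreeMonoid.ofList w)
  rw [hb]
  exact (FreeAlgebra.basisFreeMonoid ℚ (Fin n)).linearIndependent.comp _
    FreeMonoid.ofList.injective

/-- The words of length `r` form a basis permuted by `σ`, and a word is fixed exactly when each of
its letters is. -/
theorem character_ncHomogeneous (n r : ℕ) (σ : Equiv.Perm (Fin n)) :
    (ncHomogeneous n r).toRepresentation.character σ = (σ.fixCard : ℚ) ^ r := by
  let v : (Fin r → Fin n) → FreeAlgebra ℚ (Fin n) := fun w => ncMonomial (List.ofFn w)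
  have hv : LinearIndependent ℚ v :=
    (linearIndependent_ncMonomial n).comp _ List.ofFn_injective
  have hspan : Submodule.span ℚ (Set.range v) = (ncHomogeneous n r).toSubmodule := by
    change _ = Submodule.span ℚ _
    congr 1
    ext x
    constructor
    · rintro ⟨w, rfl⟩
      exact ⟨List.ofFn w, List.length_ofFn, rfl⟩
    · rintro ⟨w, rfl, rfl⟩
      exact ⟨w.get, congrArg ncMonomial (List.ofFn_get w)⟩
  let b := (Module.Basis.span hv).map (LinearEquiv.ofEq _ _ hspan)
  have hb : ∀ w, ((b w : (ncHomogeneous n r).toSubmodule) : FreeAlgebra ℚ (Fin n)) = v w :=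
    fun w => by simp [b, Module.Basis.span_apply]
  rw [Representation.character, LinearMap.trace_eq_card_fixed b _ (fun w => σ ∘ w) fun w => ?_]
  · have : (Finset.univ.filter fun w : Fin r → Fin n => σ ∘ w = w) =
        Fintype.piFinset fun _ => Finset.univ.filter fun i => σ i = i := by
      ext w
      simp [funext_iff, Fintype.mem_piFinset]
    rw [this, Fintype.card_piFinset_const, Equiv.Perm.fixCard, Nat.cast_pow]
  · refine Subtype.ext ?_
    rw [hb]
    change variableAction n σ (b w) = _
    rw [hb, variableAction_ncMonomial, List.map_ofFn]

theorem frob_ncHomogeneous (n r : ℕ) :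
    frob (ncHomogeneous n r).toRepresentation =
      ∑ d ∈ Finset.range (n + 1),
        (r.stirlingSecond d : ℚ) • (SymFun.h (n - d) * SymFun.h 1 ^ d) := by
  have hchar : ∀ σ : Equiv.Perm (Fin n),
      (ncHomogeneous n r).toRepresentation.character σ • SymFun.pProd σ.partition.parts =
        ∑ d ∈ Finset.range (n + 1), (r.stirlingSecond d : ℚ) •
          ((σ.fixCard.descFactorial d : ℚ) • SymFun.pProd σ.partition.parts) := fun σ => by
    have hle : σ.fixCard ≤ n := by
      have := σ.fixCard_add_card_support
      rw [Fintype.card_fin] at this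
      omega
    rw [character_ncHomogeneous, ← Nat.cast_pow,
      pow_eq_sum_stirlingSecond_mul_descFactorial hle, Nat.cast_sum, Finset.sum_smul]
    simp only [Nat.cast_mul, mul_smul]
  rw [frob, Finset.sum_congr rfl fun σ _ => hchar σ, Finset.sum_comm, Finset.smul_sum]
  refine Finset.sum_congr rfl fun d hd => ?_
  rw [← Finset.smul_sum, Equiv.Perm.sum_descFactorial_smul_pProd
    (Nat.le_of_lt_succ (Finset.mem_range.1 hd)), smul_comm, smul_smul, smul_smul, mul_assoc,
    inv_mul_cancel₀ (Nat.cast_ne_zero.2 n.factorial_ne_zero), mul_one]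

theorem mainTheorem7 (n : ℕ) :
    gradedFrob (ncHomogeneous n) (ncHomogeneous_isInternal n) (ncHomogeneous_finite n) =
      ∑ d ∈ Finset.range (n + 1),
        PowerSeries.map (algebraMap ℚ SymFun) (PowerSeries.X ^ d * (curlyPochhammer d)⁻¹) *
          PowerSeries.C (SymFun.hProd ((n - d) ::ₘ Multiset.replicate d 1)) := by
  ext1 r
  rw [gradedFrob, PowerSeries.coeff_mk, frob_ncHomogeneous, map_sum]
  refine Finset.sum_congr rfl fun d _ => ?_
  rw [PowerSeries.coeff_mul_C, PowerSeries.coeff_map, coeff_X_pow_mul_curlyPochhammer_inv,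
    Algebra.smul_def, SymFun.hProd, Multiset.map_cons, Multiset.prod_cons, Multiset.map_replicate,
    Multiset.prod_replicate]
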